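/- Let $(f_n)_{n\ge 0}$ be a sequence of real numbers that satisfies a homogeneous linear recurrence $$f_{n+h} = c_1 f_{n+h-1} + \dots + c_{h-1} f_{n+1} + c_h f_n, \qquad n \ge 0,$$ with constant coefficients $c_1,\dots,c_h\in\mathbb{R}$. Then the natural density of the positivity set $\{n\in\mathbb{N} : f_n > 0\}$ exists; that is, the limit $$\lim_{x\to\infty} \frac{1}{x}\,\#\{n\in\mathbb{N} : n \le x,\ f_n > 0\}$$ exists. -/

import Mathlib

/-- A set `A` of natural numbers has natural density `δ` if
`#{n ≤ x : n ∈ A} / x` tends to `δ` as `x → ∞`. -/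
def HasNaturalDensity (A : Set ℕ) (δ : ℝ) : Prop :=
  Filter.Tendsto (fun x : ℕ => ({n : ℕ | n ≤ x ∧ n ∈ A}.ncard : ℝ) / (x : ℝ))
    Filter.atTop (nhds δ)

/-- A real sequence `(f_n)_{n ≥ 0}` is a recurrence sequence if it satisfies, for all `n ≥ 0`,
a homogeneous linear recurrence
`f_{n+h} = c_1 f_{n+h-1} + ... + c_{h-1} f_{n+1} + c_h f_n` with constant real coefficients.
In `LinearRecurrence` the coefficient of `f_{n+i}`, `0 ≤ i < h`, is `coeffs i = c_{h-i}`. -/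
def IsRecurrenceSequence (f : ℕ → ℝ) : Prop :=
  ∃ E : LinearRecurrence ℝ, E.IsSolution f

/-!
A recurrence sequence is an exponential polynomial `∑ P_z(n) z ^ n` from some index on (decompose
the solution space into generalized eigenspaces of the shift). Along a residue class modulo `m` the
bases become `z ^ m`, and for a suitable `m` no ratio of two distinct bases is a root of unity any
more. It suffices to treat such a nondegenerate sequence, since densities along the residue classes
add up (`exists_hasMean_of_arith`).

Dividing a nondegenerate `f` by its dominant growth `n ^ d * R ^ n` does not change signs and leaves
a trigonometric sum `g(n) = ∑ a_z z ^ n`, `‖z‖ = 1`, up to an error tending to zero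
(`exists_dominant`). Two facts then give the density of `{n | 0 < f n}`.

* Every polynomial in `Re g`, hence by the Weierstrass theorem every continuous function of `Re g`,
  has a mean value, because each character `n ↦ z ^ n` has one.
* `g` is rarely small: the upper density of `{n | ‖g n‖ ≤ ε}` tends to zero with `ε`
  (`exists_card_small_values_le`). The usual proof combines equidistribution on a torus with the
  fact that a nonzero trigonometric polynomial vanishes only on a null set. Here it is replaced by
  an induction on the number of frequencies: if `g` is small on a set of positive density, then
  `g(n)` and `g(n + h)` are simultaneously small with positive density for some fixed `h ≥ 1`, and
  `g(n + h) - w ^ h * g(n)` is a nonzero sum without the frequency `w`.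

By the second fact the discontinuity of the indicator of positivity at `0` is harmless, and the
indicator is approximated in mean by sequences that have a mean value
(`exists_hasMean_posInd_of_tendsto`).
-/

open Filter Topology Polynomial

namespace PositivitySet

/-! ### Exponential polynomials -/

/-- `u` is, up to finitely many terms, an exponential polynomial `∑ z, P_z(n) z ^ n` with all its
bases `z` in `A`. The coefficient polynomials are encoded as a finitely supported function. -/
def IsExpPolyOn (A : Set ℂ) (u : ℕ → ℂ) : Prop :=
  ∃ P : ℂ →₀ ℂ[X], (P.support : Set ℂ) ⊆ A ∧
    ∀ᶠ n : ℕ in atTop, u n = P.sum fun z p => p.eval (n : ℂ) * z ^ n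

lemma IsExpPolyOn.zero (A : Set ℂ) : IsExpPolyOn A 0 :=
  ⟨0, by simp, by simp⟩

lemma IsExpPolyOn.add {A : Set ℂ} {u v : ℕ → ℂ} (hu : IsExpPolyOn A u) (hv : IsExpPolyOn A v) :
    IsExpPolyOn A (u + v) := by
  classical
  obtain ⟨P, hPA, hP⟩ := hu
  obtain ⟨Q, hQA, hQ⟩ := hv
  refine ⟨P + Q, fun z hz => ?_, ?_⟩
  · rcases Finset.mem_union.1 (Finsupp.support_add hz) with h | h
    exacts [hPA h, hQA h]
  · filter_upwards [hP, hQ] with n h1 h2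
    rw [Finsupp.sum_add_index' (by simp) (by simp [add_mul]), Pi.add_apply, h1, h2]

lemma IsExpPolyOn.sum {A : Set ℂ} {ι : Type*} (s : Finset ι) {u : ι → ℕ → ℂ}
    (hu : ∀ i ∈ s, IsExpPolyOn A (u i)) : IsExpPolyOn A (∑ i ∈ s, u i) :=
  Finset.sum_induction _ _ (fun _ _ => IsExpPolyOn.add) (.zero A) hu

lemma IsExpPolyOn.single {A : Set ℂ} {z : ℂ} (hz : z ∈ A) (p : ℂ[X]) :
    IsExpPolyOn A (fun n => p.eval (n : ℂ) * z ^ n) := by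
  refine ⟨Finsupp.single z p, fun w hw => ?_, .of_forall fun n => ?_⟩
  · have := Finsupp.support_single_subset hw
    simp only [Finset.mem_singleton] at this
    exact this ▸ hz
  · rw [Finsupp.sum_single_index (by simp)]

lemma IsExpPolyOn.congr {A : Set ℂ} {u v : ℕ → ℂ} (hu : IsExpPolyOn A u)
    (h : v =ᶠ[atTop] u) : IsExpPolyOn A v := by
  obtain ⟨P, hPA, hP⟩ := hu
  exact ⟨P, hPA, by filter_upwards [h, hP] with n h1 h2; rw [h1, h2]⟩

/-- Along an arithmetic progression with difference `m` the bases are replaced by their `m`-th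
powers. -/
lemma IsExpPolyOn.comp_arith {A : Set ℂ} {u : ℕ → ℂ} (hu : IsExpPolyOn A u) {m : ℕ} (hm : 0 < m)
    (r : ℕ) : IsExpPolyOn ((· ^ m) '' A) (fun q => u (m * q + r)) := by
  obtain ⟨P, hPA, hP⟩ := hu
  have h1 : IsExpPolyOn ((· ^ m) '' A) (∑ z ∈ P.support, fun q : ℕ =>
      (C (z ^ r) * (P z).comp (C (m : ℂ) * X + C (r : ℂ))).eval (q : ℂ) * (z ^ m) ^ q) :=
    IsExpPolyOn.sum _ fun z hz => IsExpPolyOn.single (Set.mem_image_of_mem _ (hPA hz)) _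
  refine h1.congr ?_
  have ht : Tendsto (fun q : ℕ => m * q + r) atTop atTop :=
    tendsto_atTop_mono (fun q => (Nat.le_mul_of_pos_left q hm).trans (Nat.le_add_right _ r)) tendsto_id
  filter_upwards [ht.eventually hP] with q hq
  rw [hq, Finsupp.sum, Finset.sum_apply]
  refine Finset.sum_congr rfl fun z _ => ?_
  simp only [eval_mul, eval_C, eval_comp, eval_add, eval_X, Nat.cast_add, Nat.cast_mul]
  ring

/-- Matrix coefficients of the powers of an endomorphism are exponential polynomials: this is the
binomial theorem for `μ + (T - μ)` on each generalized eigenspace. The eigenvalue `0` contributes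
only finitely many nonzero terms. -/
lemma isExpPolyOn_pow_apply {V : Type*} [AddCommGroup V] [Module ℂ V] [FiniteDimensional ℂ V]
    (T : Module.End ℂ V) (l : V →ₗ[ℂ] ℂ) (v : V) :
    IsExpPolyOn {0}ᶜ (fun n => l ((T ^ n) v)) := by
  have hv : v ∈ ⨆ μ, T.maxGenEigenspace μ := by
    rw [Module.End.iSup_maxGenEigenspace_eq_top]; trivial
  refine Submodule.iSup_induction (motive := fun v => IsExpPolyOn {0}ᶜ (fun n => l ((T ^ n) v)))
    _ hv (fun μ x hx => ?_) ?_ fun x y hx hy => ?_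
  · obtain ⟨k, hk⟩ := (Module.End.mem_maxGenEigenspace _ _ _).1 hx
    by_cases hμ : μ = 0
    · refine (IsExpPolyOn.zero _).congr ?_
      filter_upwards [eventually_ge_atTop k] with n hn
      subst hμ
      obtain ⟨j, rfl⟩ := Nat.exists_eq_add_of_le' hn
      simp only [zero_smul, sub_zero] at hk
      simp [pow_add, hk]
    · have h1 : IsExpPolyOn {0}ᶜ (∑ i ∈ Finset.range k, fun n : ℕ =>
          (C (l (((T - μ • 1) ^ i) x) * (μ ^ i)⁻¹ / (i.factorial : ℂ)) *
            descPochhammer ℂ i).eval (n : ℂ) * μ ^ n) :=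
        IsExpPolyOn.sum _ fun i _ => IsExpPolyOn.single hμ _
      refine h1.congr (.of_forall fun n => ?_)
      have hc : Commute (T - μ • 1) (μ • (1 : Module.End ℂ V)) :=
        (Commute.one_right _).smul_right μ
      have hT : T ^ n = ∑ i ∈ Finset.range (n + 1), (T - μ • 1) ^ i * (μ • 1) ^ (n - i) *
          ((n.choose i : ℕ) : Module.End ℂ V) := by
        rw [← hc.add_pow, sub_add_cancel]
      have hTx : l ((T ^ n) x) = ∑ i ∈ Finset.range (n + 1),
          (n.choose i : ℂ) * μ ^ (n - i) * l (((T - μ • 1) ^ i) x) := by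
        rw [hT, LinearMap.sum_apply, map_sum]
        refine Finset.sum_congr rfl fun i _ => ?_
        rw [_root_.smul_pow, one_pow, mul_smul_comm, mul_one, smul_mul_assoc,
          ← (Nat.cast_commute (n.choose i) ((T - μ • 1) ^ i)).eq, ← nsmul_eq_mul,
          LinearMap.smul_apply, LinearMap.smul_apply, map_smul, map_nsmul, smul_eq_mul,
          nsmul_eq_mul]
        ring
      have key : ∀ i, i ≤ n → (n.choose i : ℂ) * μ ^ (n - i) * l (((T - μ • 1) ^ i) x) =
          (C (l (((T - μ • 1) ^ i) x) * (μ ^ i)⁻¹ / (i.factorial : ℂ)) *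
            descPochhammer ℂ i).eval (n : ℂ) * μ ^ n := by
        intro i hi
        rw [Nat.cast_choose_eq_descPochhammer_div, pow_sub₀ _ hμ hi, eval_mul, eval_C]
        ring
      have hzero : ∀ i, n < i → (descPochhammer ℂ i).eval (n : ℂ) = 0 := by
        intro i hi
        rw [descPochhammer_eval_eq_descFactorial, Nat.descFactorial_of_lt hi, Nat.cast_zero]
      have hzero' : ∀ i, k ≤ i → ((T - μ • 1) ^ i) x = 0 := by
        intro i hi
        obtain ⟨j, rfl⟩ := Nat.exists_eq_add_of_le' hi
        rw [pow_add, Module.End.mul_apply, hk, map_zero]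
      dsimp only
      rw [hTx, Finset.sum_apply,
        Finset.sum_congr rfl fun i hi => key i (Nat.lt_succ_iff.1 (Finset.mem_range.1 hi))]
      -- The binomial sum runs over `i ≤ n`, the exponential polynomial over `i < k`; the terms in only
      -- one of the ranges vanish, by `hzero'` and `hzero` respectively.
      rcases le_total k (n + 1) with h | h
      · refine (Finset.sum_subset (Finset.range_mono h) fun i _ hi => ?_).symm
        rw [hzero' i (by simpa using hi)]
        simp
      · refine Finset.sum_subset (Finset.range_mono h) fun i _ hi => ?_
        rw [eval_mul, hzero i (by simpa using hi)]
        simp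
  · simpa [Pi.zero_def] using IsExpPolyOn.zero {0}ᶜ
  · simpa [Pi.add_def] using hx.add hy

/-- The solution space of a linear recurrence is finite-dimensional and invariant under the shift,
so its elements are exponential polynomials. -/
lemma isExpPolyOn_of_isSolution {E : LinearRecurrence ℂ} {u : ℕ → ℂ} (hu : E.IsSolution u) :
    IsExpPolyOn {0}ᶜ u := by
  let shift : (ℕ → ℂ) →ₗ[ℂ] (ℕ → ℂ) := LinearMap.funLeft ℂ ℂ Nat.succ
  have hshift : ∀ w ∈ E.solSpace, shift w ∈ E.solSpace := by
    intro w hw n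
    have := hw (n + 1)
    simpa [shift, LinearMap.funLeft_apply, add_right_comm] using this
  let T : Module.End ℂ E.solSpace := shift.restrict hshift
  let l : E.solSpace →ₗ[ℂ] ℂ := (LinearMap.proj 0).comp E.solSpace.subtype
  have : FiniteDimensional ℂ E.solSpace := Module.Finite.of_basis E.basis
  have hT : ∀ n k, (((T ^ n) ⟨u, hu⟩ : E.solSpace) : ℕ → ℂ) k = u (k + n) := by
    intro n
    induction n with
    | zero => simp
    | succ n ih =>
      intro k
      rw [pow_succ', Module.End.mul_apply]
      change (((T ^ n) ⟨u, hu⟩ : E.solSpace) : ℕ → ℂ) (k + 1) = _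
      rw [ih]
      congr 1
      ring
  have := isExpPolyOn_pow_apply T l ⟨u, hu⟩
  refine this.congr (.of_forall fun n => ?_)
  change u n = (((T ^ n) ⟨u, hu⟩ : E.solSpace) : ℕ → ℂ) 0
  rw [hT, zero_add]

/-! ### Dominant terms -/

lemma tendsto_eval_mul_pow_zero (p : ℂ[X]) {z : ℂ} (hz : ‖z‖ < 1) :
    Tendsto (fun n : ℕ => p.eval (n : ℂ) * z ^ n) atTop (𝓝 0) := by
  have h : ∀ i, Tendsto (fun n : ℕ => p.coeff i * ((n : ℂ) ^ i * z ^ n)) atTop (𝓝 0) := by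
    intro i
    rw [← mul_zero (p.coeff i)]
    refine Tendsto.const_mul _ (tendsto_zero_iff_norm_tendsto_zero.2 ?_)
    simpa using tendsto_pow_const_mul_const_pow_of_abs_lt_one i
      (r := ‖z‖) (by rwa [abs_of_nonneg (norm_nonneg z)])
  have h2 := tendsto_finsetSum (Finset.range (p.natDegree + 1)) fun i _ => h i
  rw [Finset.sum_const_zero] at h2
  refine h2.congr fun n => ?_
  rw [eval_eq_sum_range, Finset.sum_mul]
  exact Finset.sum_congr rfl fun i _ => by ring

lemma tendsto_eval_div_pow (p : ℂ[X]) {d : ℕ} (hd : p.natDegree ≤ d) :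
    Tendsto (fun n : ℕ => p.eval (n : ℂ) / (n : ℂ) ^ d) atTop (𝓝 (p.coeff d)) := by
  have h : ∀ i ∈ Finset.range (d + 1), Tendsto (fun n : ℕ => p.coeff i * ((n : ℂ) ^ i / (n : ℂ) ^ d))
      atTop (𝓝 (p.coeff i * if i = d then 1 else 0)) := by
    intro i hi
    refine Tendsto.const_mul _ ?_
    split_ifs with hid
    · subst hid
      refine tendsto_const_nhds.congr' ?_
      filter_upwards [eventually_gt_atTop 0] with n hn
      rw [div_self (pow_ne_zero _ (Nat.cast_ne_zero.2 hn.ne'))]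
    · have hlt : i < d := by
        have := Finset.mem_range.1 hi; omega
      have h3 : Tendsto (fun n : ℕ => ((n : ℂ)⁻¹) ^ (d - i)) atTop (𝓝 (0 ^ (d - i))) :=
        (tendsto_inv_atTop_nhds_zero_nat (𝕜 := ℂ)).pow (d - i)
      rw [zero_pow (by omega)] at h3
      refine h3.congr' ?_
      filter_upwards [eventually_gt_atTop 0] with n hn
      have hn' : (n : ℂ) ≠ 0 := Nat.cast_ne_zero.2 hn.ne'
      rw [inv_pow, ← one_div, div_eq_div_iff (pow_ne_zero _ hn') (pow_ne_zero _ hn'), one_mul,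
        ← pow_add, Nat.add_sub_cancel' hlt.le]
  have h2 := tendsto_finsetSum _ h
  simp only [mul_ite, mul_one, mul_zero, Finset.sum_ite_eq', Finset.mem_range, Nat.lt_succ_self,
    if_true] at h2
  refine h2.congr fun n => ?_
  rw [eval_eq_sum_range' (Nat.lt_succ_of_le hd), Finset.sum_div]
  exact Finset.sum_congr rfl fun i _ => by ring

/-- After division by the dominant growth `n ^ d * R ^ n`, a nonzero exponential polynomial is
asymptotic to a nonempty trigonometric sum with nonzero coefficients. -/
lemma exists_dominant {P : ℂ →₀ ℂ[X]} (hP : P ≠ 0) (h0 : P 0 = 0) :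
    ∃ (R : ℝ) (d : ℕ) (S : Finset ℂ), 0 < R ∧ S.Nonempty ∧ S ⊆ P.support ∧
      (∀ z ∈ S, ‖z‖ = R ∧ (P z).coeff d ≠ 0) ∧
      Tendsto (fun n : ℕ => (P.sum fun z p => p.eval (n : ℂ) * z ^ n) / ((n : ℂ) ^ d * (R : ℂ) ^ n) -
        ∑ z ∈ S, (P z).coeff d * (z / R) ^ n) atTop (𝓝 0) := by
  classical
  obtain ⟨z₀, hz₀, hmax⟩ := Finset.exists_max_image P.support (fun z => ‖z‖)
    (Finsupp.support_nonempty_iff.2 hP)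
  obtain ⟨z₁, hz₁, hmax₁⟩ := Finset.exists_max_image (P.support.filter fun z => ‖z‖ = ‖z₀‖)
    (fun z => (P z).natDegree) ⟨z₀, by simpa using hz₀⟩
  simp only [Finset.mem_filter, and_imp] at hz₁ hmax₁
  set R := ‖z₀‖ with hR
  set d := (P z₁).natDegree with hd
  have hRpos : 0 < R := by
    refine norm_pos_iff.2 ?_
    rintro rfl
    exact Finsupp.mem_support_iff.1 hz₀ h0
  have hRC : (R : ℂ) ≠ 0 := by exact_mod_cast hRpos.ne'
  refine ⟨R, d, P.support.filter fun z => ‖z‖ = R ∧ (P z).coeff d ≠ 0, hRpos,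
    ⟨z₁, by simp only [Finset.mem_filter]; exact ⟨hz₁.1, hz₁.2,
      leadingCoeff_ne_zero.2 (Finsupp.mem_support_iff.1 hz₁.1)⟩⟩,
    Finset.filter_subset _ _, fun z hz => (Finset.mem_filter.1 hz).2, ?_⟩
  have key : ∀ z ∈ P.support, Tendsto (fun n : ℕ =>
      (P z).eval (n : ℂ) * z ^ n / ((n : ℂ) ^ d * (R : ℂ) ^ n) -
      if ‖z‖ = R ∧ (P z).coeff d ≠ 0 then (P z).coeff d * (z / R) ^ n else 0) atTop (𝓝 0) := by
    intro z hz
    rcases (hmax z hz).lt_or_eq with hlt | heq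
    · have hne : ¬ (‖z‖ = R ∧ (P z).coeff d ≠ 0) := fun h => hlt.ne h.1
      simp only [if_neg hne, sub_zero]
      have hz1 : ‖z / (R : ℂ)‖ < 1 := by
        rw [norm_div, Complex.norm_real, Real.norm_of_nonneg hRpos.le, div_lt_one hRpos]
        exact hlt
      refine squeeze_zero_norm' ?_ (tendsto_zero_iff_norm_tendsto_zero.1
        (tendsto_eval_mul_pow_zero (P z) hz1))
      filter_upwards [eventually_ge_atTop 1] with n hn
      have : (P z).eval (n : ℂ) * z ^ n / ((n : ℂ) ^ d * (R : ℂ) ^ n) =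
          (P z).eval (n : ℂ) * (z / R) ^ n / (n : ℂ) ^ d := by
        rw [div_pow]; field_simp
      rw [this, norm_div]
      refine div_le_self (norm_nonneg _) ?_
      rw [norm_pow, Complex.norm_natCast]
      exact one_le_pow₀ (by exact_mod_cast hn)
    · have h1 := (tendsto_eval_div_pow (P z) (hmax₁ z hz heq)).sub_const ((P z).coeff d)
      rw [sub_self] at h1
      refine squeeze_zero_norm (fun n => le_of_eq ?_) (tendsto_zero_iff_norm_tendsto_zero.1 h1)
      have hz1 : ‖z / (R : ℂ)‖ = 1 := by
        rw [norm_div, Complex.norm_real, Real.norm_of_nonneg hRpos.le, div_eq_one_iff_eq hRpos.ne']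
        exact heq
      have : (if ‖z‖ = R ∧ (P z).coeff d ≠ 0 then (P z).coeff d * (z / R) ^ n else 0) =
          (P z).coeff d * (z / R) ^ n := by
        split_ifs with h
        · rfl
        · rw [not_and_not_right.1 h heq, zero_mul]
      rw [this]
      have : (P z).eval (n : ℂ) * z ^ n / ((n : ℂ) ^ d * (R : ℂ) ^ n) - (P z).coeff d * (z / R) ^ n =
          ((P z).eval (n : ℂ) / (n : ℂ) ^ d - (P z).coeff d) * (z / R) ^ n := by
        rw [div_pow]; ring
      rw [this, norm_mul, norm_pow, hz1, one_pow, mul_one]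
  have h2 := tendsto_finsetSum _ key
  rw [Finset.sum_const_zero] at h2
  refine h2.congr fun n => ?_
  rw [Finset.sum_sub_distrib, ← Finset.sum_div, Finset.sum_filter, Finsupp.sum]

/-! ### Small values of trigonometric sums -/

/-- An element of `A` either has no successor in `A` within distance `H`, and such elements are
more than `H` apart, or it is counted by one of the shifted intersections. -/
lemma card_filter_le_gap_add_sum (A : ℕ → Prop) [DecidablePred A] (H N : ℕ) :
    ((Finset.range N).filter A).card ≤ N / (H + 1) + 1 +
      ∑ h ∈ Finset.Icc 1 H, ((Finset.range N).filter fun n => A n ∧ A (n + h)).card := by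
  set B := (Finset.range N).filter fun n => A n ∧ ∀ h ∈ Finset.Icc 1 H, ¬ A (n + h) with hB
  have hsub : (Finset.range N).filter A ⊆ B ∪ (Finset.Icc 1 H).biUnion fun h =>
      (Finset.range N).filter fun n => A n ∧ A (n + h) := by
    intro n hn
    obtain ⟨hnN, hnA⟩ := Finset.mem_filter.1 hn
    by_cases h : ∀ h ∈ Finset.Icc 1 H, ¬ A (n + h)
    · exact Finset.mem_union_left _ (Finset.mem_filter.2 ⟨hnN, hnA, h⟩)
    · push Not at h
      obtain ⟨h, hh, hA⟩ := h
      exact Finset.mem_union_right _ (Finset.mem_biUnion.2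
        ⟨h, hh, Finset.mem_filter.2 ⟨hnN, hnA, hA⟩⟩)
  have hBcard : B.card ≤ N / (H + 1) + 1 := by
    rw [← Finset.card_range (N / (H + 1) + 1)]
    refine Finset.card_le_card_of_injOn (fun n => n / (H + 1)) (fun n hn => ?_) ?_
    · have := Finset.mem_range.1 (Finset.mem_filter.1 hn).1
      simpa using Nat.lt_succ_of_le (Nat.div_le_div_right this.le)
    · have aux : ∀ a ∈ B, ∀ b ∈ B, a / (H + 1) = b / (H + 1) → ¬ a < b := by
        intro a ha b hb hab hlt
        have h1 := Nat.div_add_mod a (H + 1)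
        have h2 := Nat.div_add_mod b (H + 1)
        have h3 : b % (H + 1) < H + 1 := Nat.mod_lt b (Nat.succ_pos H)
        rw [hab] at h1
        refine (Finset.mem_filter.1 ha).2.2 (b - a) (Finset.mem_Icc.2 ⟨by omega, by omega⟩) ?_
        rw [Nat.add_sub_cancel' hlt.le]
        exact (Finset.mem_filter.1 hb).2.1
      intro a ha b hb hab
      exact le_antisymm (not_lt.1 (aux b hb a ha hab.symm)) (not_lt.1 (aux a ha b hb hab))
  calc _ ≤ _ := Finset.card_le_card hsub
    _ ≤ _ := Finset.card_union_le _ _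
    _ ≤ _ := add_le_add hBcard Finset.card_biUnion_le

/-- A nonempty trigonometric sum `g(n) = ∑ a_z z ^ n` in which no ratio of two distinct frequencies
is a root of unity is rarely small. By induction on the number of terms: if `g` were small often,
then by `card_filter_le_gap_add_sum` both `g(n)` and `g(n + h)` would be small often for some fixed
`h`, hence so would `g(n + h) - w ^ h * g(n)`, in which the frequency `w` has been cancelled and no
other coefficient vanishes. -/
lemma exists_card_small_values_le {S : Finset ℂ} (hS : S.Nonempty) :
    ∀ a : ℂ → ℂ, (∀ z ∈ S, a z ≠ 0) → (∀ z ∈ S, ‖z‖ = 1) →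
      (∀ z ∈ S, ∀ w ∈ S, ∀ h > 0, z ^ h = w ^ h → z = w) → ∀ δ > (0 : ℝ), ∃ ε > (0 : ℝ),
      ∀ᶠ N : ℕ in atTop,
        (((Finset.range N).filter fun n => ‖∑ z ∈ S, a z * z ^ n‖ ≤ ε).card : ℝ) ≤ δ * N := by
  induction hS using Finset.Nonempty.cons_induction with
  | singleton w =>
    intro a ha hw _ δ hδ
    have haw : 0 < ‖a w‖ := norm_pos_iff.2 (ha w (by simp))
    refine ⟨‖a w‖ / 2, by positivity, .of_forall fun N => ?_⟩
    have : (Finset.range N).filter (fun n => ‖∑ z ∈ {w}, a z * z ^ n‖ ≤ ‖a w‖ / 2) = ∅ := by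
      refine Finset.filter_eq_empty_iff.2 fun n _ => ?_
      rw [Finset.sum_singleton, norm_mul, norm_pow, hw w (by simp), one_pow, mul_one]
      linarith
    rw [this]
    simpa using by positivity
  | cons w S hwS hS ih =>
    intro a ha hn hdeg δ hδ
    obtain ⟨H, hH⟩ := exists_nat_one_div_lt (show (0 : ℝ) < δ / 4 by positivity)
    have hstep : ∀ h : ℕ, ∃ ε > (0 : ℝ), 1 ≤ h → ∀ᶠ N : ℕ in atTop,
        (((Finset.range N).filter fun n =>
          ‖∑ z ∈ S, a z * (z ^ h - w ^ h) * z ^ n‖ ≤ ε).card : ℝ) ≤ δ / (4 * (H + 1)) * N := by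
      intro h
      by_cases hh : 1 ≤ h
      · have hne : ∀ z ∈ S, z ^ h - w ^ h ≠ 0 := fun z hz h0 => hwS
          (hdeg z (Finset.mem_cons_of_mem hz) w (Finset.mem_cons_self _ _) h hh
            (sub_eq_zero.1 h0) ▸ hz)
        obtain ⟨ε, hε, hN⟩ := ih (fun z => a z * (z ^ h - w ^ h))
          (fun z hz => mul_ne_zero (ha z (Finset.mem_cons_of_mem hz)) (hne z hz))
          (fun z hz => hn z (Finset.mem_cons_of_mem hz))
          (fun z hz v hv => hdeg z (Finset.mem_cons_of_mem hz) v (Finset.mem_cons_of_mem hv))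
          (δ / (4 * (H + 1))) (by positivity)
        exact ⟨ε, hε, fun _ => hN⟩
      · exact ⟨1, one_pos, fun h => absurd h hh⟩
    choose ε hε hN using hstep
    have hmin : ∃ η > (0 : ℝ), ∀ h ∈ Finset.Icc 1 H, η < ε h / 2 := by
      have h1 : ∀ᶠ η : ℝ in 𝓝[>] 0, ∀ h ∈ Finset.Icc 1 H, η < ε h / 2 :=
        (Finset.eventually_all _).2 fun h _ =>
          mem_nhdsWithin_of_mem_nhds (Iio_mem_nhds (half_pos (hε h)))
      obtain ⟨η, h2, h3⟩ := (h1.and self_mem_nhdsWithin).exists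
      exact ⟨η, h3, h2⟩
    obtain ⟨η, hη, hηε⟩ := hmin
    refine ⟨η, hη, ?_⟩
    have hall : ∀ᶠ N : ℕ in atTop, ∀ h ∈ Finset.Icc 1 H,
        (((Finset.range N).filter fun n =>
          ‖∑ z ∈ S, a z * (z ^ h - w ^ h) * z ^ n‖ ≤ ε h).card : ℝ) ≤ δ / (4 * (H + 1)) * N :=
      (Finset.eventually_all _).2 fun h hh => hN h (Finset.mem_Icc.1 hh).1
    filter_upwards [hall, tendsto_natCast_atTop_atTop.eventually_ge_atTop (2 / δ)] with N h1 h2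
    set g : ℕ → ℂ := fun n => ∑ z ∈ Finset.cons w S hwS, a z * z ^ n with hg
    have hcancel : ∀ n h, g (n + h) - w ^ h * g n =
        ∑ z ∈ S, a z * (z ^ h - w ^ h) * z ^ n := by
      intro n h
      simp only [hg, Finset.sum_cons, mul_add, Finset.mul_sum]
      rw [show ∀ x y p q : ℂ, x + y - (p + q) = (x - p) + (y - q) by intros; ring,
        ← Finset.sum_sub_distrib, show a w * w ^ (n + h) - w ^ h * (a w * w ^ n) = 0 by ring,
        zero_add]
      exact Finset.sum_congr rfl fun z _ => by ring
    have hpair : ∀ h ∈ Finset.Icc 1 H,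
        (((Finset.range N).filter fun n => ‖g n‖ ≤ η ∧ ‖g (n + h)‖ ≤ η).card : ℝ) ≤
          δ / (4 * (H + 1)) * N := by
      intro h hh
      refine le_trans ?_ (h1 h hh)
      refine Nat.cast_le.2 (Finset.card_le_card (Finset.monotone_filter_right _ ?_))
      rintro n _ ⟨hn1, hn2⟩
      rw [← hcancel]
      have hw1 : ‖w ^ h * g n‖ = ‖g n‖ := by
        rw [norm_mul, norm_pow, hn w (Finset.mem_cons_self _ _), one_pow, one_mul]
      have := norm_sub_le (g (n + h)) (w ^ h * g n)
      have := hηε h hh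
      linarith
    have hcount := card_filter_le_gap_add_sum (fun n => ‖g n‖ ≤ η) H N
    have hcount' : (((Finset.range N).filter fun n => ‖g n‖ ≤ η).card : ℝ) ≤
        ((N / (H + 1) : ℕ) : ℝ) + 1 + ∑ h ∈ Finset.Icc 1 H,
          (((Finset.range N).filter fun n => ‖g n‖ ≤ η ∧ ‖g (n + h)‖ ≤ η).card : ℝ) := by
      exact_mod_cast hcount
    have hsum := Finset.sum_le_sum hpair
    rw [Finset.sum_const, Nat.card_Icc, nsmul_eq_mul, Nat.add_sub_cancel] at hsum
    have hdiv : ((N / (H + 1) : ℕ) : ℝ) ≤ δ / 4 * N := by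
      refine (Nat.cast_div_le).trans ?_
      rw [div_eq_mul_one_div, mul_comm, Nat.cast_add_one]
      exact mul_le_mul_of_nonneg_right hH.le (Nat.cast_nonneg N)
    have hsum' : (H : ℝ) * (δ / (4 * (H + 1)) * N) ≤ δ / 4 * N := by
      have : (H : ℝ) * (δ / (4 * (H + 1)) * N) = (H / (H + 1)) * (δ / 4 * N) := by
        field_simp
      rw [this]
      refine mul_le_of_le_one_left (by positivity) ?_
      rw [div_le_one (by positivity)]
      linarith
    have h2' : 2 ≤ δ * N := by
      rw [div_le_iff₀ hδ] at h2
      linarith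
    linarith

/-! ### Mean values -/

/-- The averages of `u` over `{0, …, N - 1}` converge to `a`. -/
def HasMean (u : ℕ → ℂ) (a : ℂ) : Prop :=
  Tendsto (fun N : ℕ => (∑ n ∈ Finset.range N, u n) / (N : ℂ)) atTop (𝓝 a)

/-- The existence of a mean is preserved under approximation in mean. -/
lemma exists_hasMean_of_approx {u : ℕ → ℂ}
    (h : ∀ δ > (0 : ℝ), ∃ w a, HasMean w a ∧
      ∀ᶠ N : ℕ in atTop, ‖∑ n ∈ Finset.range N, (u n - w n)‖ ≤ δ * N) :
    ∃ a, HasMean u a := by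
  refine cauchySeq_tendsto_of_complete (Metric.cauchySeq_iff'.2 fun ε hε => ?_)
  obtain ⟨w, a, hw, hN⟩ := h (ε / 5) (by positivity)
  have hclose : ∀ᶠ N : ℕ in atTop, dist ((∑ n ∈ Finset.range N, u n) / (N : ℂ)) a < 2 * (ε / 5) := by
    filter_upwards [hN, Metric.tendsto_nhds.1 hw (ε / 5) (by positivity),
      eventually_gt_atTop 0] with N h1 h2 h3
    have h3' : (0 : ℝ) < N := Nat.cast_pos.2 h3
    have h4 : dist ((∑ n ∈ Finset.range N, u n) / (N : ℂ))
        ((∑ n ∈ Finset.range N, w n) / (N : ℂ)) ≤ ε / 5 := by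
      rw [dist_eq_norm, ← sub_div, ← Finset.sum_sub_distrib, norm_div, Complex.norm_natCast,
        div_le_iff₀ h3']
      exact h1
    linarith [dist_triangle ((∑ n ∈ Finset.range N, u n) / (N : ℂ))
      ((∑ n ∈ Finset.range N, w n) / (N : ℂ)) a]
  obtain ⟨N₀, h0⟩ := eventually_atTop.1 hclose
  refine ⟨N₀, fun N hN => ?_⟩
  have h1 := h0 N hN
  have h2 := h0 N₀ le_rfl
  rw [dist_comm] at h2
  linarith [dist_triangle ((∑ n ∈ Finset.range N, u n) / (N : ℂ)) a
    ((∑ n ∈ Finset.range N₀, u n) / (N₀ : ℂ))]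

lemma hasMean_zero : HasMean 0 0 := by simp [HasMean]

lemma HasMean.add {u v : ℕ → ℂ} {a b : ℂ} (hu : HasMean u a) (hv : HasMean v b) :
    HasMean (u + v) (a + b) := by
  refine (Tendsto.add hu hv).congr fun N => ?_
  simp only [Pi.add_apply, Finset.sum_add_distrib, add_div]

lemma HasMean.smul {u : ℕ → ℂ} {a : ℂ} (c : ℂ) (hu : HasMean u a) : HasMean (c • u) (c * a) := by
  refine (Tendsto.const_mul c hu).congr fun N => ?_
  simp only [Pi.smul_apply, smul_eq_mul, ← Finset.mul_sum, mul_div_assoc]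

lemma exists_hasMean_pow {z : ℂ} (hz : ‖z‖ = 1) : ∃ a, HasMean (fun n => z ^ n) a := by
  by_cases h1 : z = 1
  · refine ⟨1, tendsto_const_nhds.congr' ?_⟩
    filter_upwards [eventually_gt_atTop 0] with N hN
    simp [h1, hN.ne']
  · refine ⟨0, squeeze_zero_norm (a := fun N : ℕ => 2 / ‖z - 1‖ / N) (fun N => ?_)
      (tendsto_const_div_atTop_nhds_zero_nat _)⟩
    rw [geom_sum_eq h1, norm_div, norm_div, Complex.norm_natCast]
    gcongr
    refine (norm_sub_le _ _).trans ?_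
    rw [norm_pow, hz]
    norm_num

/-- The multiplicative monoid of the characters `n ↦ z ^ n`, `‖z‖ = 1`. -/
def characters : Submonoid (ℕ → ℂ) where
  carrier := {u | ∃ z : ℂ, ‖z‖ = 1 ∧ u = fun n => z ^ n}
  one_mem' := ⟨1, by simp, by ext; simp⟩
  mul_mem' := by
    rintro _ _ ⟨z, hz, rfl⟩ ⟨w, hw, rfl⟩
    exact ⟨z * w, by simp [hz, hw], by ext; simp [mul_pow]⟩

/-- The algebra of trigonometric sums. -/
def trigSums : Subalgebra ℂ (ℕ → ℂ) := Algebra.adjoin ℂ (characters : Set (ℕ → ℂ))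

lemma pow_mem_trigSums {z : ℂ} (hz : ‖z‖ = 1) : (fun n => z ^ n) ∈ trigSums :=
  Algebra.subset_adjoin ⟨z, hz, rfl⟩

lemma exists_hasMean_of_mem_trigSums {u : ℕ → ℂ} (hu : u ∈ trigSums) : ∃ a, HasMean u a := by
  have hu' : u ∈ Submodule.span ℂ (characters : Set (ℕ → ℂ)) := by
    rw [trigSums, ← Subalgebra.mem_toSubmodule, Algebra.adjoin_eq_span,
      Submonoid.closure_eq] at hu
    exact hu
  clear hu
  induction hu' using Submodule.span_induction with
  | mem x hx =>
    obtain ⟨z, hz, rfl⟩ := hx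
    exact exists_hasMean_pow hz
  | zero => exact ⟨0, hasMean_zero⟩
  | add x y _ _ hx hy =>
    obtain ⟨a, ha⟩ := hx
    obtain ⟨b, hb⟩ := hy
    exact ⟨a + b, ha.add hb⟩
  | smul c x _ hx =>
    obtain ⟨a, ha⟩ := hx
    exact ⟨c * a, ha.smul c⟩

lemma star_mem_trigSums {u : ℕ → ℂ} (hu : u ∈ trigSums) : star u ∈ trigSums := by
  induction hu using Algebra.adjoin_induction with
  | mem x hx =>
    obtain ⟨z, hz, rfl⟩ := hx
    have : star (fun n : ℕ => z ^ n) = fun n => (star z) ^ n := by ext; simp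
    rw [this]
    exact pow_mem_trigSums (by simpa using hz)
  | algebraMap r =>
    have : star (algebraMap ℂ (ℕ → ℂ) r) = algebraMap ℂ (ℕ → ℂ) (star r) := by ext; simp
    rw [this]
    exact Subalgebra.algebraMap_mem _ _
  | add x y _ _ hx hy => rw [star_add]; exact add_mem hx hy
  | mul x y _ _ hx hy => rw [star_mul]; exact mul_mem hy hx

/-- A polynomial in the real part of a trigonometric sum is again a trigonometric sum. -/
lemma exists_hasMean_eval_re {g : ℕ → ℂ} (hg : g ∈ trigSums) (p : ℝ[X]) :
    ∃ a, HasMean (fun n => ((p.eval (g n).re : ℝ) : ℂ)) a := by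
  refine exists_hasMean_of_mem_trigSums ?_
  have hre : (2⁻¹ : ℂ) • (g + star g) ∈ trigSums :=
    Subalgebra.smul_mem _ (add_mem hg (star_mem_trigSums hg)) _
  have hp : aeval ((2⁻¹ : ℂ) • (g + star g)) (p.map (algebraMap ℝ ℂ)) ∈ trigSums :=
    Algebra.adjoin_le (Set.singleton_subset_iff.2 hre) (aeval_mem_adjoin_singleton ℂ _)
  convert hp using 1
  ext n
  rw [aeval_pi]
  have h1 : ((2⁻¹ : ℂ) • (g + star g)) n = ((g n).re : ℂ) := by
    rw [Complex.re_eq_add_conj]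
    simp [div_eq_inv_mul]
  simp only [AlgHom.pi_apply, h1, coe_aeval_eq_eval, eval_map_algebraMap]
  exact (Polynomial.aeval_algebraMap_apply_eq_algebraMap_eval (A := ℂ) (g n).re p).symm

/-! ### The positivity set -/

/-- The indicator of positivity of a real sequence, as a complex-valued sequence. -/
noncomputable def posInd (v : ℕ → ℝ) (n : ℕ) : ℂ := if 0 < v n then 1 else 0

/-- If a real sequence is asymptotic to a trigonometric sum that is rarely small, then its
positivity set has a density. Indeed the indicator of positivity agrees with a continuous
function of the real part of the sum, wherever the sum is not small, and by the Weierstrass theorem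
such functions may be replaced by polynomials. -/
lemma exists_hasMean_posInd_of_tendsto {v : ℕ → ℝ} {g : ℕ → ℂ} (hg : g ∈ trigSums) {M : ℝ}
    (hM : ∀ n, ‖g n‖ ≤ M) (hvg : Tendsto (fun n => (v n : ℂ) - g n) atTop (𝓝 0))
    (hsmall : ∀ δ > (0 : ℝ), ∃ ε > (0 : ℝ), ∀ᶠ N : ℕ in atTop,
      (((Finset.range N).filter fun n => ‖g n‖ ≤ ε).card : ℝ) ≤ δ * N) :
    ∃ a, HasMean (posInd v) a := by
  refine exists_hasMean_of_approx fun δ hδ => ?_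
  obtain ⟨ε₂, hε₂, hN⟩ := hsmall (δ / 3) (by positivity)
  obtain ⟨ε, hε, rfl⟩ : ∃ ε > 0, ε₂ = 2 * ε := ⟨ε₂ / 2, by positivity, by ring⟩
  obtain ⟨p, hp⟩ := exists_polynomial_near_of_continuousOn (-M) M
    (fun x => max 0 (min 1 (x / ε))) (by fun_prop) (δ / 3) (by positivity)
  obtain ⟨a, ha⟩ := exists_hasMean_eval_re hg p
  refine ⟨_, a, ha, ?_⟩
  obtain ⟨N₀, hN₀⟩ := eventually_atTop.1 (Metric.tendsto_nhds.1 hvg ε hε)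
  have hp' : ∀ n, ‖(((max 0 (min 1 ((g n).re / ε)) : ℝ) : ℂ)) -
      ((p.eval (g n).re : ℝ) : ℂ)‖ ≤ δ / 3 := by
    intro n
    rw [← Complex.ofReal_sub, Complex.norm_real, Real.norm_eq_abs, abs_sub_comm]
    exact (hp _ (abs_le.1 ((Complex.abs_re_le_norm _).trans (hM n)))).le
  have hpt : ∀ n, ‖posInd v n - (((max 0 (min 1 ((g n).re / ε)) : ℝ) : ℂ))‖ ≤
      (if ‖g n‖ ≤ 2 * ε then 1 else 0) + if n < N₀ then 1 else 0 := by
    intro n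
    set y := (g n).re / ε with hy
    have hind : posInd v n = (((if 0 < v n then 1 else 0 : ℝ)) : ℂ) := by
      unfold posInd; split_ifs <;> simp
    have hle : |(if 0 < v n then 1 else 0 : ℝ) - max 0 (min 1 y)| ≤ 1 := by
      have h0 : 0 ≤ max 0 (min 1 y) := le_max_left _ _
      have h1 : max 0 (min 1 y) ≤ 1 := max_le zero_le_one (min_le_left _ _)
      rw [abs_le]
      split_ifs <;> constructor <;> linarith
    rw [hind, ← Complex.ofReal_sub, Complex.norm_real, Real.norm_eq_abs]
    by_cases h1 : ‖g n‖ ≤ 2 * ε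
    · rw [if_pos h1]
      split_ifs at hle ⊢ <;> linarith
    by_cases h2 : n < N₀
    · rw [if_neg h1, if_pos h2]
      linarith
    rw [if_neg h1, if_neg h2, add_zero]
    have h3 : ‖(v n : ℂ) - g n‖ < ε := by simpa using hN₀ n (not_lt.1 h2)
    have hre : |v n - (g n).re| < ε := by
      simpa using (Complex.abs_re_le_norm _).trans_lt h3
    -- Since `v n` is real, the imaginary part of `g n` is small, so `‖g n‖ > 2 * ε` forces
    -- `|Re (g n)| > ε`, and then `v n` has the sign of `Re (g n)`.
    have him : |(g n).im| < ε := by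
      simpa using (Complex.abs_im_le_norm _).trans_lt h3
    have h4 := Complex.norm_le_abs_re_add_abs_im (g n)
    have h5 : ε < |(g n).re| := by linarith [not_le.1 h1]
    rw [abs_lt] at hre
    rcases lt_abs.1 h5 with h6 | h6
    · have : 1 ≤ y := by rw [hy, le_div_iff₀ hε]; linarith
      rw [if_pos (by linarith), min_eq_left this, max_eq_right zero_le_one, sub_self, abs_zero]
    · have : y ≤ 0 := div_nonpos_of_nonpos_of_nonneg (by linarith) hε.le
      rw [if_neg (by linarith), min_eq_right (by linarith), max_eq_left this, sub_zero, abs_zero]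
  filter_upwards [hN, tendsto_natCast_atTop_atTop.eventually_ge_atTop (N₀ / (δ / 3))] with N h1 h2
  rw [div_le_iff₀ (by positivity)] at h2
  have hcard : ((((Finset.range N).filter fun n => n < N₀).card : ℕ) : ℝ) ≤ N₀ := by
    refine Nat.cast_le.2 ?_
    rw [← Finset.card_range N₀]
    refine Finset.card_le_card fun n hn => ?_
    simpa using (Finset.mem_filter.1 hn).2
  calc _ ≤ ∑ n ∈ Finset.range N, (((if ‖g n‖ ≤ 2 * ε then 1 else 0) + if n < N₀ then 1 else 0) +
          δ / 3 : ℝ) := norm_sum_le_of_le _ fun n _ => by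
        have := norm_sub_le_norm_sub_add_norm_sub (posInd v n)
          (((max 0 (min 1 ((g n).re / ε)) : ℝ) : ℂ)) ((p.eval (g n).re : ℝ) : ℂ)
        linarith [hpt n, hp' n]
    _ ≤ δ * N := by
        rw [Finset.sum_add_distrib, Finset.sum_add_distrib, Finset.sum_boole, Finset.sum_boole,
          Finset.sum_const, Finset.card_range, nsmul_eq_mul]
        linarith

lemma exists_hasMean_congr {u w : ℕ → ℂ} (h : u =ᶠ[atTop] w) (hw : ∃ a, HasMean w a) :
    ∃ a, HasMean u a := by
  obtain ⟨a, ha⟩ := hw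
  obtain ⟨N₀, hN₀⟩ := eventually_atTop.1 h
  refine exists_hasMean_of_approx fun δ hδ => ⟨w, a, ha, ?_⟩
  filter_upwards [eventually_ge_atTop N₀, tendsto_natCast_atTop_atTop.eventually_ge_atTop
    (‖∑ n ∈ Finset.range N₀, (u n - w n)‖ / δ)] with N h1 h2
  rw [div_le_iff₀ hδ] at h2
  rw [← Finset.sum_subset (Finset.range_mono h1) fun n _ hn => ?_]
  · linarith
  · rw [hN₀ n (by simpa using hn), sub_self]

/-- The case in which no ratio of two distinct bases is a root of unity. -/
lemma exists_hasMean_posInd_of_nondegenerate {A : Set ℂ} (h0 : (0 : ℂ) ∉ A)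
    (hA : ∀ z ∈ A, ∀ w ∈ A, ∀ h > 0, z ^ h = w ^ h → z = w) {f : ℕ → ℝ}
    (hf : IsExpPolyOn A (fun n => (f n : ℂ))) : ∃ a, HasMean (posInd f) a := by
  obtain ⟨P, hPA, hP⟩ := hf
  by_cases hP0 : P = 0
  · refine exists_hasMean_congr (w := 0) ?_ ⟨0, hasMean_zero⟩
    filter_upwards [hP] with n hn
    rw [hP0, Finsupp.sum_zero_index] at hn
    simp [posInd, Complex.ofReal_eq_zero.1 hn]
  have hP0' : P 0 = 0 := by
    by_contra h
    exact h0 (hPA (Finsupp.mem_support_iff.2 h))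
  obtain ⟨R, d, S, hR, hS, hSP, hSR, hlim⟩ := exists_dominant hP0 hP0'
  have hRC : (R : ℂ) ≠ 0 := by exact_mod_cast hR.ne'
  set v : ℕ → ℝ := fun n => f n / ((n : ℝ) ^ d * R ^ n) with hv
  set g : ℕ → ℂ := fun n => ∑ z ∈ S, (P z).coeff d * (z / R) ^ n with hg
  have hnorm : ∀ z ∈ S, ‖z / (R : ℂ)‖ = 1 := fun z hz => by
    rw [norm_div, (hSR z hz).1, Complex.norm_real, Real.norm_of_nonneg hR.le, div_self hR.ne']
  have hgt : g ∈ trigSums := by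
    have : g = ∑ z ∈ S, (P z).coeff d • fun n : ℕ => (z / (R : ℂ)) ^ n := by
      ext n; simp [hg]
    rw [this]
    exact sum_mem fun z hz => Subalgebra.smul_mem _ (pow_mem_trigSums (hnorm z hz)) _
  have hM : ∀ n, ‖g n‖ ≤ ∑ z ∈ S, ‖(P z).coeff d‖ := fun n =>
    norm_sum_le_of_le _ fun z hz => by rw [norm_mul, norm_pow, hnorm z hz, one_pow, mul_one]
  have hvg : Tendsto (fun n => (v n : ℂ) - g n) atTop (𝓝 0) := by
    refine hlim.congr' ?_
    filter_upwards [hP] with n hn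
    rw [← hn]
    simp [hv, hg]
  have hsmall : ∀ δ > (0 : ℝ), ∃ ε > (0 : ℝ), ∀ᶠ N : ℕ in atTop,
      (((Finset.range N).filter fun n => ‖g n‖ ≤ ε).card : ℝ) ≤ δ * N := by
    have hg' : ∀ n, g n = ∑ w ∈ S.image (· / (R : ℂ)), (P (w * R)).coeff d * w ^ n := by
      intro n
      rw [Finset.sum_image fun x _ y _ hxy => (div_left_inj' hRC).1 hxy]
      exact Finset.sum_congr rfl fun z _ => by rw [div_mul_cancel₀ _ hRC]
    simp only [hg']
    refine exists_card_small_values_le (hS.image _) (fun w => (P (w * R)).coeff d) ?_ ?_ ?_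
    · simp only [Finset.forall_mem_image]
      intro z hz
      rw [div_mul_cancel₀ _ hRC]
      exact (hSR z hz).2
    · simpa only [Finset.forall_mem_image] using hnorm
    · simp only [Finset.forall_mem_image]
      intro z hz w hw h hh hzw
      rw [div_pow, div_pow, div_left_inj' (pow_ne_zero _ hRC)] at hzw
      rw [hA z (hPA (hSP hz)) w (hPA (hSP hw)) h hh hzw]
  refine exists_hasMean_congr ?_ (exists_hasMean_posInd_of_tendsto hgt hM hvg hsmall)
  -- At `n = 0` the divisor `n ^ d` may vanish, so the signs are compared for `n > 0` only.
  filter_upwards [eventually_gt_atTop 0] with n hn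
  have hpos : 0 < (n : ℝ) ^ d * R ^ n := by positivity
  simp only [posInd, hv, div_pos_iff_of_pos_right hpos]

/-! ### Arithmetic progressions -/

/-- If a bounded sequence has a mean along every residue class modulo `m`, then it has a mean. -/
lemma exists_hasMean_of_arith {u : ℕ → ℂ} (hu : ∀ n, ‖u n‖ ≤ 1) {m : ℕ} (hm : 0 < m)
    (h : ∀ r, ∃ a, HasMean (fun q => u (m * q + r)) a) : ∃ a, HasMean u a := by
  choose a ha using h
  have hsum : ∀ Q, ∑ n ∈ Finset.range (m * Q), u n =
      ∑ r ∈ Finset.range m, ∑ q ∈ Finset.range Q, u (m * q + r) := by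
    intro Q
    induction Q with
    | zero => simp
    | succ Q ih =>
      rw [Nat.mul_succ, Finset.sum_range_add, ih, ← Finset.sum_add_distrib]
      exact Finset.sum_congr rfl fun r _ => (Finset.sum_range_succ _ _).symm
  have hQ : Tendsto (fun N : ℕ => N / m) atTop atTop := Nat.tendsto_div_const_atTop hm.ne'
  have hratio : Tendsto (fun N : ℕ => ((N / m : ℕ) : ℂ) / (N : ℂ)) atTop (𝓝 ((m : ℂ)⁻¹)) := by
    have h1 := (tendsto_nat_floor_mul_div_atTop (R := ℝ) (a := (m : ℝ)⁻¹) (by positivity)).comp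
      tendsto_natCast_atTop_atTop
    have h2 := (Complex.continuous_ofReal.tendsto _).comp h1
    rw [Complex.ofReal_inv, Complex.ofReal_natCast] at h2
    refine h2.congr fun N => ?_
    simp only [Function.comp_apply]
    rw [inv_mul_eq_div, Nat.floor_div_eq_div]
    simp
  have hmain := (tendsto_finsetSum (Finset.range m) fun r _ => (ha r).comp hQ).mul hratio
  have herr : Tendsto (fun N : ℕ => (∑ n ∈ Finset.range N, u n) / (N : ℂ) -
      (∑ n ∈ Finset.range (m * (N / m)), u n) / (N : ℂ)) atTop (𝓝 0) := by
    refine squeeze_zero_norm (a := fun N : ℕ => (m : ℝ) / N) (fun N => ?_)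
      (tendsto_const_div_atTop_nhds_zero_nat _)
    rw [← sub_div, norm_div, Complex.norm_natCast]
    gcongr
    have h1 : (∑ n ∈ Finset.range N, u n) = ∑ n ∈ Finset.range (m * (N / m) + N % m), u n := by
      rw [Nat.div_add_mod]
    rw [h1, Finset.sum_range_add, add_sub_cancel_left]
    refine (norm_sum_le_of_le _ fun n _ => hu _).trans ?_
    simpa using (Nat.mod_lt N hm).le
  refine ⟨_, (hmain.add herr).congr' ?_⟩
  filter_upwards [hQ.eventually_gt_atTop 0] with N hN
  have hN' : ((N / m : ℕ) : ℂ) ≠ 0 := Nat.cast_ne_zero.2 hN.ne'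
  simp only [Function.comp_apply]
  rw [← Finset.sum_div, ← hsum, div_mul_div_cancel₀ hN']
  ring

/-- A common exponent `m` after which the elements of a finite set have no root-of-unity ratios
left, other than `1`. -/
lemma exists_pow_eq_of_pow_eq (S : Finset ℂ) : ∃ m > 0, ∀ z ∈ S, ∀ w ∈ S, ∀ h > 0,
    z ^ h = w ^ h → z ^ m = w ^ m := by
  have : ∀ x : ℂ × ℂ, ∃ N > 0, ∀ h > 0, x.1 ^ h = x.2 ^ h → x.1 ^ N = x.2 ^ N := by
    intro x
    by_cases hx : ∃ h > 0, x.1 ^ h = x.2 ^ h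
    · obtain ⟨N, hN, hx⟩ := hx
      exact ⟨N, hN, fun _ _ _ => hx⟩
    · exact ⟨1, one_pos, fun h hh hxh => absurd ⟨h, hh, hxh⟩ hx⟩
  choose N hN hx using this
  refine ⟨∏ x ∈ S ×ˢ S, N x, Finset.prod_pos fun x _ => hN x, fun z hz w hw h hh hzw => ?_⟩
  obtain ⟨k, hk⟩ := Finset.dvd_prod_of_mem N (Finset.mk_mem_product hz hw)
  rw [hk, pow_mul, pow_mul, hx (z, w) h hh hzw]

lemma exists_hasMean_posInd {f : ℕ → ℝ} (hf : IsExpPolyOn {0}ᶜ (fun n => (f n : ℂ))) :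
    ∃ a, HasMean (posInd f) a := by
  obtain ⟨P, hPA, hP⟩ := hf
  obtain ⟨m, hm, hmS⟩ := exists_pow_eq_of_pow_eq P.support
  have hfP : IsExpPolyOn (P.support : Set ℂ) (fun n => (f n : ℂ)) := ⟨P, subset_rfl, hP⟩
  refine exists_hasMean_of_arith (fun n => ?_) hm fun r => ?_
  · unfold posInd; split_ifs <;> simp
  · refine exists_hasMean_posInd_of_nondegenerate (A := (· ^ m) '' (P.support : Set ℂ))
      (f := fun q => f (m * q + r)) ?_ ?_ (hfP.comp_arith hm r)
    · rintro ⟨z, hz, hz0⟩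
      exact hPA hz (pow_eq_zero_iff hm.ne' |>.1 hz0)
    · rintro _ ⟨z, hz, rfl⟩ _ ⟨w, hw, rfl⟩ h hh hzw
      refine hmS z hz w hw (m * h) (by positivity) ?_
      simpa only [pow_mul] using hzw

lemma hasNaturalDensity_of_hasMean {f : ℕ → ℝ} {a : ℂ} (ha : HasMean (posInd f) a) :
    HasNaturalDensity {n : ℕ | 0 < f n} a.re := by
  -- The density counts the `x + 1` numbers `n ≤ x` but divides by `x`.
  have h1 : Tendsto (fun x : ℕ => ((x : ℝ) + 1) / x) atTop (𝓝 1) := by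
    have := (tendsto_one_div_atTop_nhds_zero_nat (𝕜 := ℝ)).const_add 1
    rw [add_zero] at this
    refine this.congr' ?_
    filter_upwards [eventually_gt_atTop 0] with x hx
    field_simp
  have h2 := (((Complex.continuous_re.tendsto a).comp ha).comp (tendsto_add_atTop_nat 1)).mul h1
  rw [mul_one] at h2
  refine h2.congr fun x => ?_
  have hset : {n : ℕ | n ≤ x ∧ n ∈ {n : ℕ | 0 < f n}} =
      ((Finset.range (x + 1)).filter fun n => 0 < f n : Finset ℕ) := by
    ext n; simp
  have hsum : (∑ n ∈ Finset.range (x + 1), posInd f n) =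
      ((((Finset.range (x + 1)).filter fun n => 0 < f n).card : ℝ) : ℂ) := by
    simp [posInd, Finset.sum_boole]
  simp only [Function.comp_apply]
  rw [hset, Set.ncard_coe_finset, hsum, ← Complex.ofReal_natCast (x + 1), ← Complex.ofReal_div,
    Complex.ofReal_re, Nat.cast_add_one, div_mul_div_cancel₀ (by positivity)]

end PositivitySet

theorem theorem1 (f : ℕ → ℝ) (hf : IsRecurrenceSequence f) :
    ∃ δ : ℝ, HasNaturalDensity {n : ℕ | 0 < f n} δ := by
  obtain ⟨E, hE⟩ := hf
  have hE' : LinearRecurrence.IsSolution ⟨E.order, fun i => (E.coeffs i : ℂ)⟩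
      (fun n => (f n : ℂ)) := by
    intro n
    have := hE n
    simp only
    rw [this]
    push_cast
    rfl
  obtain ⟨a, ha⟩ := PositivitySet.exists_hasMean_posInd
    (PositivitySet.isExpPolyOn_of_isSolution hE')
  exact ⟨a.re, PositivitySet.hasNaturalDensity_of_hasMean ha⟩
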